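/- For a group $H$ let $H'$ denote its commutator subgroup. Let $G$ be a group. The following are equivalent. (a) There exists a group $H$ that is elementarily equivalent to $G$ (satisfies the same first-order sentences in the language of groups) such that the abelianization $H/H'$ is nontrivial and cotorsion. Here an abelian group $A$ is cotorsion if every short exact sequence of abelian groups $0 \to A \to B \to C \to 0$ with $C$ torsion-free splits. (b) Either $G$ is not perfect (that is, $G' \neq G$), or $G$ has elements of unbounded commutator length: for every natural number $n$ there is an element of $G'$ that is not a product of at most $n$ commutators. -/

import Mathlib

universe u v

/-- The function symbols of the first-order language of groups: multiplication, inversion and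
the identity element. -/
inductive GroupFunc : ℕ → Type
  | mul : GroupFunc 2
  | inv : GroupFunc 1
  | one : GroupFunc 0

/-- The first-order language of groups (no relation symbols besides equality). -/
def groupLanguage : FirstOrder.Language :=
  { Functions := GroupFunc
    Relations := fun _ => Empty }

/-- A group, seen as a structure for the language of groups. -/
@[reducible]
def groupStructure (G : Type u) [Group G] : groupLanguage.Structure G where
  funMap := fun {n} f =>
    match n, f with
    | _, GroupFunc.mul => fun x => x 0 * x 1
    | _, GroupFunc.inv => fun x => (x 0)⁻¹
    | _, GroupFunc.one => fun _ => 1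
  RelMap := fun r => r.elim

/-- Two groups are elementarily equivalent if they satisfy the same first-order sentences in the
language of groups. -/
def GroupElementarilyEquivalent (G : Type u) (H : Type v) [Group G] [Group H] : Prop :=
  letI := groupStructure G
  letI := groupStructure H
  groupLanguage.ElementarilyEquivalent G H

/-- An abelian group `A` is cotorsion if every short exact sequence of abelian groups
`0 → A → B → C → 0` with `C` torsion-free splits. -/
def IsCotorsion (A : Type u) [AddCommGroup A] : Prop :=
  ∀ (B C : Type u) [AddCommGroup B] [AddCommGroup C] [IsAddTorsionFree C]
    (f : A →+ B) (g : B →+ C),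
    Function.Injective f → Function.Exact f g → Function.Surjective g →
      ∃ s : C →+ B, g.comp s = AddMonoidHom.id C

/-- The commutator length of `g`: the least number of commutators whose product is `g`, and `⊤`
if `g` is not a product of commutators. -/
noncomputable def commutatorLength {G : Type u} [Group G] (g : G) : ℕ∞ :=
  ⨅ (l : List G) (_ : (∀ x ∈ l, x ∈ commutatorSet G) ∧ l.prod = g), (l.length : ℕ∞)

/-- The elements of the commutator subgroup of `G` (those of finite commutator length) have
unbounded commutator length. -/
def HasUnboundedCommutatorLength (G : Type u) [Group G] : Prop :=
  ∀ n : ℕ, ∃ g ∈ commutator G, (n : ℕ∞) < commutatorLength g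

/-! If `G` is perfect with commutator lengths at most `n`, then "every element is a product of `n`
commutators" is a first-order sentence true in `G`, so every elementarily equivalent group is
perfect. Otherwise let `H` be an ultrapower over `ℕ`, equivalent to `G` by Łoś. A product of `n`
commutators in `H` is one in almost all coordinates, so a constant outside `G'`, or a sequence of
growing commutator length, survives in `H/H'`. Diagonally, `H` solves countable triangular systems,
and solutions descend to `A = H/H'`. Solving `b n = (n + 1) • b (n + 1) + a n` in `A` amounts to
`Ext(ℚ, A) = 0`, whence `Ext(C, A) = 0` for torsion-free `C`, which embeds in a `ℚ`-vector space. -/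

open FirstOrder Filter
open scoped commutatorElement

/-! ### Products of boundedly many commutators -/

section CommutatorProducts

variable {G : Type u} [Group G]

/-- `g` is a product of exactly `n` commutators. As `1` is a commutator, this amounts to being a
product of at most `n` commutators. -/
def IsCommutatorProduct (n : ℕ) (g : G) : Prop :=
  ∃ p q : Fin n → G, (List.ofFn fun i => ⁅p i, q i⁆).prod = g

theorem isCommutatorProduct_iff_exists_list {n : ℕ} {g : G} :
    IsCommutatorProduct n g ↔
      ∃ l : List G, (∀ x ∈ l, x ∈ commutatorSet G) ∧ l.prod = g ∧ l.length = n := by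
  constructor
  · rintro ⟨p, q, h⟩
    refine ⟨_, ?_, h, by simp⟩
    intro x hx
    obtain ⟨i, rfl⟩ := List.mem_ofFn.1 hx
    exact ⟨p i, q i, rfl⟩
  · rintro ⟨l, hl, rfl, rfl⟩
    choose p q hpq using fun i : Fin l.length => hl (l.get i) (l.get_mem i)
    refine ⟨p, q, ?_⟩
    simp only [hpq]
    rw [List.ofFn_get]

theorem IsCommutatorProduct.mono {m n : ℕ} (hmn : m ≤ n) {g : G} (h : IsCommutatorProduct m g) :
    IsCommutatorProduct n g := by
  obtain ⟨l, hl, hg, hm⟩ := isCommutatorProduct_iff_exists_list.1 h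
  refine isCommutatorProduct_iff_exists_list.2
    ⟨l ++ List.replicate (n - m) 1, fun x hx => ?_, by simp [hg], by simp [hm]; omega⟩
  rcases List.mem_append.1 hx with hx | hx
  · exact hl x hx
  · rw [List.eq_of_mem_replicate hx]
    exact ⟨1, 1, by simp⟩

theorem mem_commutator_iff_exists_isCommutatorProduct {g : G} :
    g ∈ commutator G ↔ ∃ n, IsCommutatorProduct n g := by
  simp only [isCommutatorProduct_iff_exists_list]
  rw [commutator_eq_closure]
  constructor
  · intro h
    rw [← Subgroup.mem_toSubmonoid, Subgroup.closure_toSubmonoid] at h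
    obtain ⟨l, hl, hg⟩ := Submonoid.exists_list_of_mem_closure h
    refine ⟨l.length, l, fun x hx => ?_, hg, rfl⟩
    rcases hl x hx with hx | ⟨a, b, hab⟩
    · exact hx
    · exact ⟨b, a, by rw [← commutatorElement_inv, hab, inv_inv]⟩
  · rintro ⟨-, l, hl, rfl, -⟩
    exact Subgroup.list_prod_mem _ fun x hx => Subgroup.subset_closure (hl x hx)

theorem commutatorLength_le_iff {n : ℕ} {g : G} :
    commutatorLength g ≤ n ↔ IsCommutatorProduct n g := by
  constructor
  · intro h
    have h' : commutatorLength g < ((n + 1 : ℕ) : ℕ∞) :=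
      h.trans_lt (by exact_mod_cast Nat.lt_succ_self n)
    simp only [commutatorLength, iInf_lt_iff] at h'
    obtain ⟨l, ⟨hl, hg⟩, hn⟩ := h'
    exact (isCommutatorProduct_iff_exists_list.2 ⟨l, hl, hg, rfl⟩).mono
      (Nat.lt_succ_iff.1 (by exact_mod_cast hn))
  · intro h
    obtain ⟨l, hl, hg, rfl⟩ := isCommutatorProduct_iff_exists_list.1 h
    exact iInf₂_le l ⟨hl, hg⟩

theorem nontrivial_abelianization_iff : Nontrivial (Abelianization G) ↔ commutator G ≠ ⊤ :=
  QuotientGroup.nontrivial_iff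

end CommutatorProducts

/-! ### First-order expressibility and Łoś's theorem -/

section FirstOrder

/-- The term which is the product of a list of terms in the language of groups. -/
def groupLanguage.prodTerm {α : Type v} : List (groupLanguage.Term α) → groupLanguage.Term α
  | [] => Language.Term.func GroupFunc.one ![]
  | t :: l => Language.Term.func GroupFunc.mul ![t, prodTerm l]

/-- The term which is the commutator of two terms in the language of groups. -/
def groupLanguage.commutatorTerm {α : Type v} (s t : groupLanguage.Term α) :
    groupLanguage.Term α :=
  prodTerm [s, t, Language.Term.func GroupFunc.inv ![s], Language.Term.func GroupFunc.inv ![t] ]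

variable {G : Type u} [Group G]

theorem groupLanguage.realize_prodTerm {α : Type v} (l : List (groupLanguage.Term α)) (x : α → G) :
    letI := groupStructure G
    (prodTerm l).realize x = (l.map fun t => t.realize x).prod := by
  let _ := groupStructure G
  induction l with
  | nil => rfl
  | cons t l ih =>
    rw [List.map_cons, List.prod_cons, ← ih]
    rfl

theorem groupLanguage.realize_commutatorTerm {α : Type v} (s t : groupLanguage.Term α)
    (x : α → G) :
    letI := groupStructure G
    (commutatorTerm s t).realize x = ⁅s.realize x, t.realize x⁆ := by
  let _ := groupStructure G
  rw [commutatorTerm, realize_prodTerm]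
  simp only [List.map_cons, List.map_nil, List.prod_cons, List.prod_nil, mul_one,
    commutatorElement_def, mul_assoc]
  rfl

/-- The sentence stating that each element is a product of `n` commutators. -/
noncomputable def commutatorWidthSentence (n : ℕ) : groupLanguage.Sentence :=
  Language.Formula.iAlls (α := Empty) Unit <|
    Language.Formula.iExs (α := Empty ⊕ Unit) (Fin n × Bool) <|
      Language.Term.equal
        (groupLanguage.prodTerm <| List.ofFn fun i : Fin n => groupLanguage.commutatorTerm
          (Language.Term.var (Sum.inr (i, false))) (Language.Term.var (Sum.inr (i, true))))
        (Language.Term.var (Sum.inl (Sum.inr ())))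

theorem realize_commutatorWidthSentence (n : ℕ) :
    letI := groupStructure G
    G ⊨ commutatorWidthSentence n ↔ ∀ g : G, IsCommutatorProduct n g := by
  let _ := groupStructure G
  simp only [Language.Sentence.Realize, commutatorWidthSentence, Language.Formula.realize_iAlls,
    Language.Formula.realize_iExs, Language.Formula.realize_equal,
    groupLanguage.realize_prodTerm, List.map_ofFn, Function.comp_def,
    groupLanguage.realize_commutatorTerm, Language.Term.realize_var, Sum.elim_inr, Sum.elim_inl]
  constructor
  · intro h g
    obtain ⟨y, hy⟩ := h fun _ => g
    exact ⟨fun i => y (i, false), fun i => y (i, true), hy⟩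
  · intro h x
    obtain ⟨p, q, hpq⟩ := h (x ())
    exact ⟨fun i => if i.2 then q i.1 else p i.1, by simpa using hpq⟩

/-- **Łoś's theorem** for ultrapowers of groups. -/
theorem groupElementarilyEquivalent_germ {ι : Type v} (U : Ultrafilter ι) (G : Type u) [Group G] :
    GroupElementarilyEquivalent G (Germ (U : Filter ι) G) := by
  let _ := groupStructure G
  let _ := groupStructure (Germ (U : Filter ι) G)
  have e : groupLanguage.Equiv ((U : Filter ι).Product fun _ => G) (Germ (U : Filter ι) G) :=
    { toFun := fun x => x
      invFun := fun x => x
      left_inv := fun _ => rfl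
      right_inv := fun _ => rfl
      map_fun' := by
        intro n f x
        obtain ⟨y, rfl⟩ : ∃ y : Fin n → ι → G,
            x = fun i => (y i : (U : Filter ι).Product fun _ => G) :=
          ⟨fun i => (x i).out, funext fun i => (Quotient.out_eq _).symm⟩
        refine (Language.Ultraproduct.funMap_cast f y).trans ?_
        cases f <;> rfl
      map_rel' := fun r => r.elim }
  refine Language.elementarilyEquivalent_iff.2 fun φ => ?_
  rw [← Language.StrongHomClass.realize_sentence e φ, Language.Ultraproduct.sentence_realize,
    eventually_const]

end FirstOrder

/-! ### Commutators and equations in ultrapowers -/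

section Ultrapower

variable {G : Type u} [Group G]

theorem eventually_isCommutatorProduct_of_germ {ι : Type v} {l : Filter ι} {n : ℕ} {f : ι → G}
    (h : IsCommutatorProduct n (f : Germ l G)) : ∀ᶠ i in l, IsCommutatorProduct n (f i) := by
  obtain ⟨p, q, h⟩ := h
  have hp : ∀ i, ∃ p' : ι → G, (p' : Germ l G) = p i := fun i => Quotient.exists_rep (p i)
  have hq : ∀ i, ∃ q' : ι → G, (q' : Germ l G) = q i := fun i => Quotient.exists_rep (q i)
  choose p' hp' using hp
  choose q' hq' using hq
  have key : (Germ.coeMulHom l : (ι → G) →* Germ l G)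
      (List.ofFn fun i => ⁅p' i, q' i⁆).prod = (f : Germ l G) := by
    rw [map_list_prod, ← h, List.map_ofFn]
    congr 2
    funext i
    rw [Function.comp_apply, map_commutatorElement, Germ.coe_coeMulHom, hp', hq']
  filter_upwards [Germ.coe_eq.1 key] with i hi
  refine ⟨fun j => p' j i, fun j => q' j i, ?_⟩
  rw [← hi]
  refine Eq.trans ?_ (map_list_prod (Pi.evalMonoidHom (fun _ => G) i) _).symm
  rw [List.map_ofFn]
  rfl

/-- Countable ultrapowers solve every triangular system of equations `b n = b (n + 1) ^ m n * a n`.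
-/
theorem exists_germ_pow_mul_eq (a : ℕ → Germ (hyperfilter ℕ : Filter ℕ) G) (m : ℕ → ℕ) :
    ∃ b : ℕ → Germ (hyperfilter ℕ : Filter ℕ) G, ∀ n, b n = b (n + 1) ^ m n * a n := by
  have ha : ∀ n, ∃ a' : ℕ → G, (a' : Germ (hyperfilter ℕ : Filter ℕ) G) = a n :=
    fun n => Quotient.exists_rep (a n)
  choose a' ha' using ha
  -- Coordinate `i` need only satisfy the equations with `n < i`, as each `n` is eventually below
  -- `i`. Start from `b i = 1` and substitute backwards: `c k` is `b (i - k)`.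
  have hb (i : ℕ) : ∃ b : ℕ → G, ∀ n < i, b n = b (n + 1) ^ m n * a' n i := by
    let c : ℕ → G := fun k => Nat.rec 1 (fun k x => x ^ m (i - (k + 1)) * a' (i - (k + 1)) i) k
    refine ⟨fun n => c (i - n), fun n hn => ?_⟩
    obtain ⟨k, rfl⟩ := Nat.exists_eq_add_of_lt hn
    have h1 : n + k + 1 - n = k + 1 := by omega
    have h2 : n + k + 1 - (n + 1) = k := by omega
    have h3 : n + k + 1 - (k + 1) = n := by omega
    simp only [h1, h2]
    simp only [c, h3]
  choose b hb using hb
  refine ⟨fun n => ((fun i => b i n : ℕ → G) : Germ (hyperfilter ℕ : Filter ℕ) G), fun n => ?_⟩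
  rw [← ha' n, ← Germ.coe_pow, ← Germ.coe_mul, Germ.coe_eq]
  have hn : ∀ᶠ i in (hyperfilter ℕ : Filter ℕ), n < i :=
    Nat.hyperfilter_le_atTop (eventually_gt_atTop n)
  filter_upwards [hn] with i hi using hb i n hi

theorem nontrivial_abelianization_germ_hyperfilter
    (h : ¬ Group.IsPerfect G ∨ HasUnboundedCommutatorLength G) :
    Nontrivial (Abelianization (Germ (hyperfilter ℕ : Filter ℕ) G)) := by
  rw [nontrivial_abelianization_iff]
  intro htop
  have key (f : ℕ → G) : ∃ n, ∀ᶠ i in (hyperfilter ℕ : Filter ℕ), IsCommutatorProduct n (f i) := by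
    have hf : (f : Germ (hyperfilter ℕ : Filter ℕ) G) ∈ commutator _ := htop ▸ Subgroup.mem_top _
    obtain ⟨n, hn⟩ := mem_commutator_iff_exists_isCommutatorProduct.1 hf
    exact ⟨n, eventually_isCommutatorProduct_of_germ hn⟩
  rcases h with h | h
  · refine h (Group.isPerfect_def.2 ((Subgroup.eq_top_iff' _).2 fun g => ?_))
    obtain ⟨n, hn⟩ := key fun _ => g
    exact mem_commutator_iff_exists_isCommutatorProduct.2 ⟨n, eventually_const.1 hn⟩
  -- The element `f i` has length greater than `i`, so no fixed `n` bounds it once `n ≤ i`.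
  · choose f _ hf using id h
    obtain ⟨n, hn⟩ := key f
    have hle : ∀ᶠ i in (hyperfilter ℕ : Filter ℕ), n ≤ i :=
      Nat.hyperfilter_le_atTop (eventually_ge_atTop n)
    obtain ⟨i, hi, hni⟩ := (hn.and hle).exists
    exact (hf i).not_ge (commutatorLength_le_iff.2 (hi.mono hni))

end Ultrapower

/-! ### Cotorsion from solvable systems -/

section Cotorsion

open Nat

/-- A compatible sequence, viewed as images of `1 / n !`, defines a homomorphism on `ℚ`. -/
theorem exists_ratHom_of_factorial_sequence {A : Type u} [AddCommGroup A] (z : ℕ → A)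
    (hz : ∀ n, (n + 1) • z (n + 1) = z n) :
    ∃ f : ℚ →+ A, ∀ (n : ℕ) (k : ℤ), f (k / n !) = k • z n := by
  -- The value `k • z n` for `q = k / n !` does not change when `n` grows; `n = q.den` is always
  -- large enough.
  have hstep (n d : ℕ) (k : ℤ) (q : ℚ) (hq : q * n ! = k) :
      ∃ k' : ℤ, q * (n + d)! = k' ∧ k' • z (n + d) = k • z n := by
    induction d with
    | zero => exact ⟨k, hq, rfl⟩
    | succ d ih =>
      obtain ⟨k', h1, h2⟩ := ih
      refine ⟨k' * ((n + d + 1 : ℕ) : ℤ), ?_, ?_⟩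
      · rw [← add_assoc, Nat.factorial_succ]
        push_cast at h1 ⊢
        rw [← h1]
        ring
      · rw [mul_smul, natCast_zsmul, ← add_assoc, hz, h2]
  have hden (q : ℚ) : ∃ k : ℤ, q * (q.den)! = k := by
    obtain ⟨c, hc⟩ := Nat.dvd_factorial q.den_pos le_rfl
    refine ⟨q.num * c, ?_⟩
    rw [hc]
    push_cast
    rw [← mul_assoc, Rat.mul_den_eq_num]
  choose k hk using hden
  have heq (q : ℚ) (n : ℕ) (j : ℤ) (hj : q * n ! = j) : k q • z q.den = j • z n := by
    obtain ⟨j₁, h1, h2⟩ := hstep _ n _ q (hk q)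
    obtain ⟨j₂, h3, h4⟩ := hstep _ q.den _ q hj
    rw [add_comm n] at h3 h4
    have : j₁ = j₂ := by exact_mod_cast h1.symm.trans h3
    rw [← h2, ← h4, this]
  refine ⟨AddMonoidHom.mk' (fun q => k q • z q.den) fun q r => ?_, fun n j => ?_⟩
  · obtain ⟨j₁, h1, h2⟩ := hstep _ r.den _ q (hk q)
    obtain ⟨j₂, h3, h4⟩ := hstep _ q.den _ r (hk r)
    rw [add_comm r.den] at h3 h4
    change k (q + r) • z (q + r).den = k q • z q.den + k r • z r.den
    rw [← h2, ← h4, ← add_smul]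
    exact heq _ _ _ (by push_cast; rw [← h1, ← h3]; ring)
  · refine heq _ _ _ ?_
    have : (n ! : ℚ) ≠ 0 := by exact_mod_cast n.factorial_ne_zero
    field_simp

/-- If the systems `b n = (n + 1) • b (n + 1) + a n` are solvable in the kernel of a surjective
homomorphism, then homomorphisms out of `ℚ` lift along it. -/
theorem exists_ratHom_lift {A I J : Type*} [AddCommGroup A] [AddCommGroup I] [AddCommGroup J]
    (hA : ∀ a : ℕ → A, ∃ b : ℕ → A, ∀ n, b n = (n + 1) • b (n + 1) + a n)
    {i : A →+ I} {p : I →+ J} (hip : Function.Exact i p) (hp : Function.Surjective p)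
    (ψ : ℚ →+ J) : ∃ θ : ℚ →+ I, p.comp θ = ψ := by
  choose y hy using fun n : ℕ => hp (ψ (1 / n !))
  have hfac (n : ℕ) : (n + 1) • (1 / (n + 1)! : ℚ) = 1 / n ! := by
    have : (n ! : ℚ) ≠ 0 := by exact_mod_cast n.factorial_ne_zero
    rw [Nat.factorial_succ, nsmul_eq_mul]
    push_cast
    field_simp
  have hker (n : ℕ) : ∃ a : A, i a = y n - (n + 1) • y (n + 1) := by
    refine (hip _).1 ?_
    rw [map_sub, map_nsmul, hy, hy, ← map_nsmul, hfac, sub_self]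
  choose a ha using hker
  obtain ⟨b, hb⟩ := hA a
  -- The lifts `y n` of `ψ (1 / n !)` are compatible up to the errors `a n`; subtracting `b n`
  -- removes them.
  obtain ⟨θ, hθ⟩ := exists_ratHom_of_factorial_sequence (fun n => y n - i (b n)) fun n => by
    rw [hb n, map_add, ha, map_nsmul, smul_sub]
    abel
  refine ⟨θ, AddMonoidHom.ext fun q => ?_⟩
  have hden : (q.num : ℚ) / q.den = q := q.num_div_den
  obtain ⟨c, hc⟩ := Nat.dvd_factorial q.den_pos le_rfl
  have hc0 : (c : ℚ) ≠ 0 := by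
    rintro h
    have h0 : c = 0 := by exact_mod_cast h
    exact (q.den).factorial_ne_zero (by rw [hc, h0, mul_zero])
  have hq : q = ((q.num * c : ℤ) : ℚ) / (q.den)! := by
    rw [hc]
    push_cast
    rw [mul_div_mul_right _ _ hc0, hden]
  have hq' : q = (q.num * c : ℤ) • (1 / (q.den)! : ℚ) := by
    rw [zsmul_eq_mul, mul_one_div]
    exact hq
  have h1 : p (θ q) = (q.num * c : ℤ) • ψ (1 / (q.den)!) := by
    conv_lhs => rw [hq, hθ]
    rw [map_zsmul, map_sub, hy, hip.apply_apply_eq_zero, sub_zero]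
  rw [AddMonoidHom.comp_apply, h1, ← map_zsmul, ← hq']

/-- Every abelian group embeds into a divisible, hence injective, abelian group. -/
theorem exists_embedding_divisibleBy (A : Type u) [AddCommGroup A] :
    ∃ (I : Type u) (_ : AddCommGroup I) (_ : DivisibleBy I ℤ) (i : A →+ I),
      Function.Injective i := by
  refine ⟨CharacterModule A → AddCircle (1 : ℚ), inferInstance, inferInstance,
    AddMonoidHom.mk' (fun a c => c a) fun a b => funext fun c => map_add c a b, ?_⟩
  rw [injective_iff_map_eq_zero]
  exact fun a ha => CharacterModule.eq_zero_of_character_apply fun c => congrFun ha c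

/-- Extend `f`'s inverse to `Φ : B → I` with `I` divisible. It induces `C → I/A`, which extends to
the divisible hull of `C` and lifts to `Θ` with values in `I`, one basis line `ℚ` at a time. Then `Φ
- Θ ∘ g` lands in `A` and retracts `f`. -/
theorem isCotorsion_of_solvable {A : Type u} [AddCommGroup A]
    (hA : ∀ a : ℕ → A, ∃ b : ℕ → A, ∀ n, b n = (n + 1) • b (n + 1) + a n) : IsCotorsion A := by
  intro B C _ _ _ f g hf hfg hg
  obtain ⟨I, _, _, i, hi⟩ := exists_embedding_divisibleBy A
  let p : I →+ I ⧸ i.range := QuotientAddGroup.mk' i.range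
  have hp : Function.Surjective p := QuotientAddGroup.mk'_surjective _
  have hip : Function.Exact i p := fun x => QuotientAddGroup.eq_zero_iff x
  obtain ⟨Φ, hΦ⟩ := (Module.Baer.of_divisible I).extension_property_addMonoidHom f hf i
  let s : C → B := Function.surjInv hg
  have hs (c : C) : g (s c) = c := Function.surjInv_eq hg c
  have hker (x : B) (hx : g x = 0) : p (Φ x) = 0 := by
    obtain ⟨a, rfl⟩ := (hfg x).1 hx
    rw [show Φ (f a) = i a from DFunLike.congr_fun hΦ a, hip.apply_apply_eq_zero]
  have hdiff (x y : B) (h : g x = g y) : p (Φ x) = p (Φ y) := by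
    rw [← sub_eq_zero, ← map_sub, ← map_sub]
    exact hker _ (by rw [map_sub, h, sub_self])
  let χ : C →+ I ⧸ i.range := AddMonoidHom.mk' (fun c => p (Φ (s c))) fun c d => by
    rw [← map_add, ← map_add]
    exact hdiff _ _ (by rw [map_add, hs, hs, hs])
  let _ : DivisibleBy (I ⧸ i.range) ℤ := hp.divisibleBy p fun x n => map_zsmul p n x
  obtain ⟨χ', hχ'⟩ := (Module.Baer.of_divisible (I ⧸ i.range)).extension_property_addMonoidHom
    (DivisibleHull.coeAddMonoidHom C) DivisibleHull.coe_injective χ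
  let β := Module.Free.chooseBasis ℚ (DivisibleHull C)
  choose θ hθ using fun j => exists_ratHom_lift hA hip hp
    (χ'.comp (β.repr.symm.toLinearMap.toAddMonoidHom.comp (Finsupp.singleAddHom j)))
  let Θ : DivisibleHull C →+ I :=
    (Finsupp.liftAddHom θ).comp β.repr.toLinearMap.toAddMonoidHom
  have hΘ (v : DivisibleHull C) : p (Θ v) = χ' v := by
    have h : p.comp (Finsupp.liftAddHom θ) =
        χ'.comp β.repr.symm.toLinearMap.toAddMonoidHom := by
      refine Finsupp.addHom_ext fun j q => ?_
      have := DFunLike.congr_fun (hθ j) q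
      simpa using this
    have := DFunLike.congr_fun h (β.repr v)
    simpa [Θ] using this
  have hret (x : B) : ∃ a : A, i a = Φ x - Θ (g x : C) := by
    refine (hip _).1 ?_
    rw [map_sub, hΘ, sub_eq_zero]
    have h : χ' (g x : C) = χ (g x) := DFunLike.congr_fun hχ' (g x)
    rw [h]
    exact hdiff _ _ (hs _).symm
  choose r hr using hret
  have hradd (x y : B) : r (x + y) = r x + r y := by
    apply hi
    rw [map_add, hr, hr, hr, map_add, map_add, DivisibleHull.coe_add, map_add]
    abel
  let ρ : B →+ A := AddMonoidHom.mk' r hradd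
  have hρ (a : A) : ρ (f a) = a := by
    apply hi
    change i (r (f a)) = i a
    rw [hr, hfg.apply_apply_eq_zero, show Φ (f a) = i a from DFunLike.congr_fun hΦ a]
    have h0 : ((0 : C) : DivisibleHull C) = 0 := map_zero (DivisibleHull.coeAddMonoidHom C)
    rw [h0, map_zero, sub_zero]
  have hkerσ (x : B) (hx : g x = 0) : x - f (ρ x) = 0 := by
    obtain ⟨a, rfl⟩ := (hfg x).1 hx
    rw [hρ, sub_self]
  -- The set-theoretic section `s` becomes additive once its `A`-component is removed.
  refine ⟨AddMonoidHom.mk' (fun c => s c - f (ρ (s c))) fun c d => ?_, AddMonoidHom.ext fun c => ?_⟩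
  · have := hkerσ (s (c + d) - (s c + s d)) (by rw [map_sub, map_add, hs, hs, hs, sub_self])
    rw [← sub_eq_zero, ← this]
    simp only [map_sub, map_add]
    abel
  · change g (s c - f (ρ (s c))) = c
    rw [map_sub, hs, hfg.apply_apply_eq_zero, sub_zero]

theorem isCotorsion_abelianization_germ_hyperfilter (G : Type u) [Group G] :
    IsCotorsion (Additive (Abelianization (Germ (hyperfilter ℕ : Filter ℕ) G))) := by
  refine isCotorsion_of_solvable fun a => ?_
  choose a' ha' using fun n => QuotientGroup.mk_surjective (a n).toMul
  obtain ⟨b, hb⟩ := exists_germ_pow_mul_eq a' fun n => n + 1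
  refine ⟨fun n => Additive.ofMul (Abelianization.of (b n)), fun n => ?_⟩
  have ha : a n = Additive.ofMul (Abelianization.of (a' n)) :=
    congrArg Additive.ofMul (ha' n).symm
  rw [ha, ← ofMul_pow, ← ofMul_mul, ← map_pow, ← map_mul, ← hb]

end Cotorsion

theorem mainTheorem6 (G : Type u) [Group G] :
    (∃ (H : Type u) (_ : Group H),
      GroupElementarilyEquivalent G H ∧
      Nontrivial (Abelianization H) ∧
      IsCotorsion (Additive (Abelianization H))) ↔
    (¬ Group.IsPerfect G ∨ HasUnboundedCommutatorLength G) := by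
  constructor
  · rintro ⟨H, _, hGH, hH, -⟩
    by_contra! h
    obtain ⟨hperf, hbdd⟩ := h
    simp only [HasUnboundedCommutatorLength, not_forall, not_exists, not_and, not_lt] at hbdd
    obtain ⟨n, hn⟩ := hbdd
    let _ := groupStructure G
    let _ := groupStructure H
    have hG : G ⊨ commutatorWidthSentence n := (realize_commutatorWidthSentence n).2 fun g =>
      commutatorLength_le_iff.1 (hn g Group.IsPerfect.mem_commutator)
    have hGH' : groupLanguage.ElementarilyEquivalent G H := hGH
    have hH' := (realize_commutatorWidthSentence n).1 ((hGH'.realize_sentence _).1 hG)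
    exact nontrivial_abelianization_iff.1 hH ((Subgroup.eq_top_iff' _).2 fun x =>
      mem_commutator_iff_exists_isCommutatorProduct.2 ⟨n, hH' x⟩)
  · intro h
    exact ⟨Germ (hyperfilter ℕ : Filter ℕ) G, inferInstance,
      groupElementarilyEquivalent_germ (hyperfilter ℕ) G,
      nontrivial_abelianization_germ_hyperfilter h,
      isCotorsion_abelianization_germ_hyperfilter G⟩
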